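/- Let $d\ge 2$ and let $V=\{n\in\mathbb Z^d:\gcd(n_1,\dots,n_d)=1\}=\mathbb Z^d\setminus\bigcup_{p\text{ prime}}p\,\mathbb Z^d$ be the set of visible points of $\mathbb Z^d$. Identify subsets of $\mathbb Z^d$ with configurations in $\{0,1\}^{\mathbb Z^d}$ (product topology) via characteristic functions, let $\mathbb Z^d$ act by the shifts $(T_tx)_n=x_{n+t}$, and let $\mathbb X_V=\overline{\{t+V:t\in\mathbb Z^d\}}$ be the orbit closure of $V$. Write $\mathrm{Aut}(\mathbb X_V)$ for the group of all self-homeomorphisms of $\mathbb X_V$ and $\mathcal G=\{T_t:t\in\mathbb Z^d\}\subseteq\mathrm{Aut}(\mathbb X_V)$ for the group of shifts. Then: (1) The topological dynamical system $(\mathbb X_V,\mathbb Z^d)$ has topological entropy $\log(2)/\zeta(d)$, where $\zeta$ is the Riemann zeta function. (2) $\mathbb X_V=\mathbb A$, where $\mathbb A$ is the set of all $U\subseteq\mathbb Z^d$ such that, for every prime $p$, $U$ misses at least one coset of $p\,\mathbb Z^d$ in $\mathbb Z^d$. (3) The map $t\mapsto T_t$ is an isomorphism $\mathbb Z^d\to\mathcal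 G$, and the symmetry group $\mathcal S(\mathbb X_V)$, that is, the centraliser of $\mathcal G$ in $\mathrm{Aut}(\mathbb X_V)$, equals $\mathcal G$; so $\mathcal S(\mathbb X_V)=\mathbb Z^d$. (4) For the extended symmetry group $\mathcal R(\mathbb X_V)$, that is, the normaliser of $\mathcal G$ in $\mathrm{Aut}(\mathbb X_V)$, one has $\mathcal R(\mathbb X_V)=\mathbb Z^d\rtimes\mathrm{GL}(d,\mathbb Z)$: with the multiplication $(t,M)(s,N)=(t+Ms,MN)$ on $\mathbb Z^d\rtimes\mathrm{GL}(d,\mathbb Z)$, the map $(t,M)\mapsto T_t\circ H_M$, where $(H_Mx)_n=x_{M^{-1}n}$, is a group isomorphism onto $\mathcal R(\mathbb X_V)$. -/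

import Mathlib

open SymbolicDynamics.FullShift in
/-- The `ℤ^d`-action on a subshift `X ⊆ A^(ℤ^d)` by homeomorphisms: `(T_t x)_n = x_(t + n)`. -/
def shiftAction {A : Type*} [TopologicalSpace A] {d : ℕ} (X : Subshift A (Fin d → ℤ)) :
    Multiplicative (Fin d → ℤ) →* (X.carrier ≃ₜ X.carrier) where
  toFun t :=
    { toFun := fun x => ⟨shift t.toAdd x.1, X.mapsTo _ x.2⟩
      invFun := fun x => ⟨shift (-t.toAdd) x.1, X.mapsTo _ x.2⟩
      left_inv := fun x => by ext n; simp
      right_inv := fun x => by ext n; simp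
      continuous_toFun := by fun_prop
      continuous_invFun := by fun_prop }
  map_one' := by
    refine Homeomorph.ext fun x => Subtype.ext (funext fun n => ?_)
    change x.1 (0 + n) = x.1 n
    rw [zero_add]
  map_mul' s t := by
    refine Homeomorph.ext fun x => Subtype.ext (funext fun n => ?_)
    change x.1 (s.toAdd + t.toAdd + n) = x.1 (t.toAdd + (s.toAdd + n))
    rw [← add_assoc, add_comm t.toAdd]

/-- The symmetry group (topological centraliser) of a subshift: the centraliser of the group of
shifts in the group of all self-homeomorphisms. -/
def symmetryGroup {A : Type*} [TopologicalSpace A] {d : ℕ}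
    (X : SymbolicDynamics.FullShift.Subshift A (Fin d → ℤ)) :
    Subgroup (X.carrier ≃ₜ X.carrier) :=
  Subgroup.centralizer ((shiftAction X).range : Set (X.carrier ≃ₜ X.carrier))

/-- The extended symmetry group (topological normaliser) of a subshift: the normaliser of the
group of shifts in the group of all self-homeomorphisms. -/
def extendedSymmetryGroup {A : Type*} [TopologicalSpace A] {d : ℕ}
    (X : SymbolicDynamics.FullShift.Subshift A (Fin d → ℤ)) :
    Subgroup (X.carrier ≃ₜ X.carrier) :=
  Subgroup.normalizer ((shiftAction X).range : Set (X.carrier ≃ₜ X.carrier))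

/-- The minimal cardinality of a finite subcover of the cover `𝒰` (of a compact space). -/
noncomputable def minSubcoverCard {X : Type*} (𝒰 : Set (Set X)) : ℕ :=
  sInf {k | ∃ ℱ : Finset (Set X), (ℱ : Set (Set X)) ⊆ 𝒰 ∧
    ⋃₀ (ℱ : Set (Set X)) = Set.univ ∧ ℱ.card = k}

/-- The join `⋁_{t ∈ F} T_t⁻¹ 𝒰` of the preimages of the cover `𝒰`. -/
def joinCover {ι X : Type*} (T : ι → X → X) (𝒰 : Set (Set X)) (F : Finset ι) : Set (Set X) :=
  {W | ∃ u : ι → Set X, (∀ t ∈ F, u t ∈ 𝒰) ∧ W = ⋂ t ∈ F, T t ⁻¹' u t}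

/-- The cube `{0, …, n - 1}^d ⊆ ℤ^d`. -/
noncomputable def cube (d n : ℕ) : Finset (Fin d → ℤ) :=
  Fintype.piFinset fun _ => Finset.Ico 0 (n : ℤ)

/-- The topological entropy (Adler–Konheim–McAndrew) of an action of `ℤ^d` by homeomorphisms of
a compact space: the supremum over all open covers `𝒰` of the exponential growth rate of the
minimal subcover of `⋁_{t ∈ {0, …, n - 1}^d} T_t⁻¹ 𝒰`, relative to the volume `n ^ d`. -/
noncomputable def topologicalEntropy {d : ℕ} {X : Type*} [TopologicalSpace X]
    (T : Multiplicative (Fin d → ℤ) →* (X ≃ₜ X)) : EReal :=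
  ⨆ 𝒰 ∈ {𝒰 : Set (Set X) | (∀ u ∈ 𝒰, IsOpen u) ∧ ⋃₀ 𝒰 = Set.univ},
    Filter.limsup (fun n : ℕ =>
      ((Real.log (minSubcoverCard
        (joinCover (fun t : Fin d → ℤ => T (Multiplicative.ofAdd t)) 𝒰 (cube d n)))
          / (n : ℝ) ^ d : ℝ) : EReal)) Filter.atTop

open Classical in
/-- The characteristic function of a subset of `ℤ^d`, as a binary configuration. -/
noncomputable def configOf {d : ℕ} (U : Set (Fin d → ℤ)) : (Fin d → ℤ) → Bool :=
  fun n => decide (n ∈ U)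

/-- The subset of `ℤ^d` encoded by a binary configuration. -/
def configSupport {d : ℕ} (x : (Fin d → ℤ) → Bool) : Set (Fin d → ℤ) :=
  {n | x n = true}

open SymbolicDynamics.FullShift in
/-- The hull of a subset of `ℤ^d`: the closure, in the product topology of `{0,1}^(ℤ^d)`, of the
set of its translates. -/
noncomputable def hull {d : ℕ} (U : Set (Fin d → ℤ)) : Subshift Bool (Fin d → ℤ) where
  carrier := closure (Set.range fun t : Fin d → ℤ => shift t (configOf U))
  isClosed := isClosed_closure
  mapsTo g := by
    refine Set.MapsTo.closure ?_ (continuous_shift g)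
    rintro _ ⟨t, rfl⟩
    exact ⟨t + g, shift_add t g _⟩

/-- The visible (primitive) points of `ℤ^d`. -/
def visiblePoints (d : ℕ) : Set (Fin d → ℤ) :=
  {n | Finset.univ.gcd n = 1}

/-- The coset `c + m ℤ^d`. -/
def latticeCoset {d : ℕ} (m : ℕ) (c : Fin d → ℤ) : Set (Fin d → ℤ) :=
  Set.range fun k : Fin d → ℤ => c + (m : ℤ) • k

/-- A subset of `ℤ^d` is admissible if it misses a coset of `p ℤ^d` for every prime `p`. -/
def IsAdmissible {d : ℕ} (U : Set (Fin d → ℤ)) : Prop :=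
  ∀ p : ℕ, p.Prime → ∃ c : Fin d → ℤ, Disjoint U (latticeCoset p c)

/-- The natural action of `GL(d, ℤ)` on `ℤ^d` by automorphisms. -/
def glAut (d : ℕ) :
    Matrix.GeneralLinearGroup (Fin d) ℤ →* MulAut (Multiplicative (Fin d → ℤ)) where
  toFun M :=
    { toFun := fun t => Multiplicative.ofAdd (M.val.mulVec t.toAdd)
      invFun := fun t => Multiplicative.ofAdd (M⁻¹.val.mulVec t.toAdd)
      left_inv := fun t => by
        beta_reduce
        rw [toAdd_ofAdd, Matrix.mulVec_mulVec, ← Units.val_mul, inv_mul_cancel, Units.val_one,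
          Matrix.one_mulVec, ofAdd_toAdd]
      right_inv := fun t => by
        beta_reduce
        rw [toAdd_ofAdd, Matrix.mulVec_mulVec, ← Units.val_mul, mul_inv_cancel, Units.val_one,
          Matrix.one_mulVec, ofAdd_toAdd]
      map_mul' := fun s t => by
        rw [toAdd_mul, Matrix.mulVec_add, ofAdd_add] }
  map_one' := by
    ext1 t
    change Multiplicative.ofAdd ((1 : Matrix (Fin d) (Fin d) ℤ).mulVec t.toAdd) = t
    rw [Matrix.one_mulVec, ofAdd_toAdd]
  map_mul' M N := by
    ext1 t
    change Multiplicative.ofAdd ((M.val * N.val).mulVec t.toAdd)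
      = Multiplicative.ofAdd (M.val.mulVec (N.val.mulVec t.toAdd))
    rw [Matrix.mulVec_mulVec]

/-! Everything is expressed through the relation `Misses p c x`: the configuration `x` avoids the
class `c` modulo `p`.

Hull. Missing some class modulo each prime is a closed, shift-invariant condition satisfied by V.
Conversely, let x be admissible and F a finite window. By the Chinese remainder theorem there is t
with t ≡ -c_p modulo small primes, where c_p is missed by x, and t ≡ -n modulo a private large prime
for each n in F outside x. The remaining primes are made harmless using two coordinates of t, which
is where d ≥ 2 enters. Hence V shows the pattern of x at t (`exists_visiblePoints_eq`), and t may be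
prescribed modulo one prime.

Centraliser. A symmetry S translates the missed classes modulo p by a fixed s_p
(`exists_misses_add_iff`). Any point m of S{0} satisfies m ≡ s_p for all p, so T_m S preserves
missed classes. Finite sets are determined by these classes and are dense, so T_m S = 1.

Normaliser. Conjugation by S induces an automorphism M of ℤ^d, and S H_M⁻¹ centralises the shifts.

Entropy. Above: a pattern is a subset of what remains after deleting one class for each p < P, and P
→ ∞ gives the Euler product of 1/ζ(d). Below: greedily deleting sparse classes leaves at least
|F|/ζ(d) points of F, all of whose subsets are admissible. -/

/-! ### Residues, visibility and missed classes -/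

/-- Coordinatewise reduction of an integer vector modulo `p`. -/
def redMod {d : ℕ} (p : ℕ) (n : Fin d → ℤ) : Fin d → ZMod p := fun i => (n i : ZMod p)

theorem redMod_add {d p : ℕ} (m n : Fin d → ℤ) : redMod p (m + n) = redMod p m + redMod p n := by
  ext i; simp [redMod]

theorem redMod_sub {d p : ℕ} (m n : Fin d → ℤ) : redMod p (m - n) = redMod p m - redMod p n := by
  ext i; simp [redMod]

theorem redMod_zero {d p : ℕ} : redMod p (0 : Fin d → ℤ) = 0 := by
  ext i; simp [redMod]

theorem redMod_surjective {d : ℕ} (p : ℕ) : Function.Surjective (redMod (d := d) p) := fun c =>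
  ⟨fun i => (ZMod.intCast_surjective (c i)).choose,
    funext fun i => (ZMod.intCast_surjective (c i)).choose_spec⟩

theorem redMod_eq_iff {d p : ℕ} (m n : Fin d → ℤ) :
    redMod p m = redMod p n ↔ ∀ i, (p : ℤ) ∣ m i - n i := by
  simp only [funext_iff, redMod]
  refine forall_congr' fun i => ?_
  rw [← sub_eq_zero, ← Int.cast_sub, ZMod.intCast_zmod_eq_zero_iff_dvd]

theorem mem_latticeCoset_iff {d p : ℕ} (c n : Fin d → ℤ) :
    n ∈ latticeCoset p c ↔ redMod p n = redMod p c := by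
  rw [redMod_eq_iff]
  constructor
  · rintro ⟨k, rfl⟩ i
    simp
  · intro h
    choose k hk using h
    refine ⟨k, funext fun i => ?_⟩
    have := hk i
    simp only [Pi.add_apply, Pi.smul_apply, smul_eq_mul]
    omega

theorem mem_visiblePoints_iff {d : ℕ} (n : Fin d → ℤ) :
    n ∈ visiblePoints d ↔ ∀ p : ℕ, p.Prime → redMod p n ≠ 0 := by
  have key : ∀ p : ℕ, redMod p n = 0 ↔ (p : ℤ) ∣ Finset.univ.gcd n := by
    intro p
    rw [← redMod_zero, redMod_eq_iff, Finset.dvd_gcd_iff]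
    simp
  have hnn : 0 ≤ Finset.univ.gcd n := by
    rw [← Finset.normalize_gcd]
    exact Int.nonneg_of_normalize_eq_self (normalize_idem _)
  simp only [ne_eq, key]
  change Finset.univ.gcd n = 1 ↔ _
  constructor
  · intro h p hp hdvd
    rw [h] at hdvd
    exact hp.one_lt.ne' (by exact_mod_cast Int.eq_one_of_dvd_one (by positivity) hdvd)
  · intro h
    by_contra hne
    obtain ⟨p, hp, hdvd⟩ := Nat.exists_prime_and_dvd (n := (Finset.univ.gcd n).natAbs) (by omega)
    exact h p hp (Int.natCast_dvd.2 hdvd)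

theorem visiblePoints_eq_compl_iUnion (d : ℕ) :
    visiblePoints d = (⋃ p ∈ {p : ℕ | p.Prime}, latticeCoset p (0 : Fin d → ℤ))ᶜ := by
  ext n
  simp [mem_visiblePoints_iff, mem_latticeCoset_iff, redMod_zero]

theorem configOf_eq_true {d : ℕ} (U : Set (Fin d → ℤ)) (n : Fin d → ℤ) :
    configOf U n = true ↔ n ∈ U := by
  simp [configOf]

/-- The configuration `x` vanishes on the residue class `c` modulo `p`. -/
def Misses {d : ℕ} (p : ℕ) (c : Fin d → ZMod p) (x : (Fin d → ℤ) → Bool) : Prop :=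
  ∀ n, x n = true → redMod p n ≠ c

theorem isAdmissible_iff {d : ℕ} (x : (Fin d → ℤ) → Bool) :
    IsAdmissible (configSupport x) ↔ ∀ p : ℕ, p.Prime → ∃ c, Misses p c x := by
  refine forall₂_congr fun p hp => ?_
  rw [(redMod_surjective p).exists]
  refine exists_congr fun c => ?_
  rw [Set.disjoint_left]
  simp only [mem_latticeCoset_iff]
  rfl

theorem misses_shift_iff {d p : ℕ} (c : Fin d → ZMod p) (t : Fin d → ℤ)
    (x : (Fin d → ℤ) → Bool) :
    Misses p c (SymbolicDynamics.FullShift.shift t x) ↔ Misses p (c + redMod p t) x := by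
  constructor
  · intro h n hn hc
    refine h (n - t) (by simpa using hn) ?_
    rw [redMod_sub, hc, add_sub_cancel_right]
  · intro h n hn hc
    refine h (t + n) hn ?_
    rw [redMod_add, hc, add_comm]

theorem misses_visiblePoints {d p : ℕ} (hp : p.Prime) :
    Misses p 0 (configOf (visiblePoints d)) := fun n hn =>
  (mem_visiblePoints_iff n).1 ((configOf_eq_true _ _).1 hn) p hp

theorem isClosed_ne_true {ι : Type*} (n : ι) : IsClosed {x : ι → Bool | ¬ x n = true} := by
  have : {x : ι → Bool | ¬ x n = true} = (fun x => x n) ⁻¹' {false} := by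
    ext x; simp
  rw [this]
  exact (isClosed_discrete _).preimage (continuous_apply n)

theorem isClosed_misses {d p : ℕ} (c : Fin d → ZMod p) :
    IsClosed {x : (Fin d → ℤ) → Bool | Misses p c x} := by
  simp only [Misses, Set.ofPred_forall]
  refine isClosed_iInter fun n => ?_
  by_cases h : redMod p n = c
  · simp only [h, ne_eq, not_true, imp_false]
    exact isClosed_ne_true n
  · simp [h]

/-- A prime has only finitely many residue classes, so the existential over classes is a finite
union of closed sets. -/
theorem isClosed_admissible (d : ℕ) :
    IsClosed {x : (Fin d → ℤ) → Bool | IsAdmissible (configSupport x)} := by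
  simp only [isAdmissible_iff, Set.ofPred_forall, Set.ofPred_exists]
  refine isClosed_iInter fun p => isClosed_iInter fun hp => ?_
  have : NeZero p := ⟨hp.ne_zero⟩
  exact isClosed_iUnion_of_finite fun c => isClosed_misses c

/-! ### Chinese remainders and the description of the hull -/

/-- Chinese remainder theorem for finitely many primes. -/
theorem exists_int_eq_residues {s : Finset ℕ} (hs : ∀ p ∈ s, p.Prime) (a : ∀ p, ZMod p) :
    ∃ z : ℤ, ∀ p ∈ s, (z : ZMod p) = a p := by
  obtain ⟨k, hk⟩ := Nat.chineseRemainderOfFinset (fun p => (a p).val) id s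
    (fun p hp => (hs p hp).ne_zero)
    (fun p hp q hq hpq => (Nat.coprime_primes (hs p hp) (hs q hq)).2 hpq)
  refine ⟨k, fun p hp => ?_⟩
  have : NeZero p := ⟨(hs p hp).ne_zero⟩
  have := (ZMod.natCast_eq_natCast_iff _ _ _).2 (hk p hp)
  simpa using this

/-- Chinese remainder theorem for finitely many primes, with an arbitrarily large solution. -/
theorem exists_int_gt_eq_residues {s : Finset ℕ} (hs : ∀ p ∈ s, p.Prime) (a : ∀ p, ZMod p)
    (K : ℤ) : ∃ z : ℤ, K < z ∧ ∀ p ∈ s, (z : ZMod p) = a p := by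
  obtain ⟨z, hz⟩ := exists_int_eq_residues hs a
  have hM : 0 < ∏ p ∈ s, (p : ℤ) :=
    Finset.prod_pos fun p hp => by exact_mod_cast (hs p hp).pos
  refine ⟨z + (∏ p ∈ s, (p : ℤ)) * (|z| + |K| + 1), ?_, fun p hp => ?_⟩
  · nlinarith [neg_abs_le z, le_abs_self K, abs_nonneg z, abs_nonneg K]
  · have : ((∏ p ∈ s, (p : ℤ) : ℤ) : ZMod p) = 0 :=
      (ZMod.intCast_zmod_eq_zero_iff_dvd _ _).2 (Finset.dvd_prod_of_mem (fun p : ℕ => (p : ℤ)) hp)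
    rw [Int.cast_add, Int.cast_mul, this, zero_mul, add_zero, hz p hp]

/-- A residue class modulo a large prime avoiding a finite set of classes. -/
theorem exists_zmod_add_ne_zero {α : Type*} (F : Finset α) (f : α → ℤ) {p : ℕ} (hp : F.card < p) :
    ∃ a : ZMod p, ∀ n ∈ F, a + (f n : ZMod p) ≠ 0 := by
  have : NeZero p := ⟨by omega⟩
  obtain ⟨a, ha⟩ : ∃ a : ZMod p, a ∉ F.image fun n => -(f n : ZMod p) := by
    by_contra! h
    have h1 : (Finset.univ : Finset (ZMod p)).card ≤ F.card :=
      (Finset.card_le_card fun a _ => h a).trans Finset.card_image_le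
    rw [Finset.card_univ, ZMod.card] at h1
    omega
  refine ⟨a, fun n hn h0 => ha ?_⟩
  exact Finset.mem_image.2 ⟨n, hn, (eq_neg_of_add_eq_zero_left h0).symm⟩

/-- Distinct vectors of a finite set are distinct modulo every sufficiently large number. -/
theorem exists_bound_redMod_injOn {d : ℕ} (F : Finset (Fin d → ℤ)) :
    ∃ B : ℕ, ∀ p > B, ∀ m ∈ F, ∀ n ∈ F, redMod p m = redMod p n → m = n := by
  -- The sum dominates every coordinate difference within `F`, so a larger modulus divides such a
  -- difference only if it is zero.
  refine ⟨F.sum (fun m => F.sum fun n => Finset.univ.sum fun i => (m i - n i).natAbs),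
    fun p hp m hm n hn h => funext fun i => ?_⟩
  have h1 := (redMod_eq_iff m n).1 h i
  have h2 : (m i - n i).natAbs ≤
      F.sum (fun m => F.sum fun n => Finset.univ.sum fun i => (m i - n i).natAbs) :=
    ((Finset.single_le_sum (f := fun i => (m i - n i).natAbs) (fun _ _ => Nat.zero_le _)
      (Finset.mem_univ i)).trans (Finset.single_le_sum
        (f := fun n => Finset.univ.sum fun i => (m i - n i).natAbs)
        (fun _ _ => Nat.zero_le _) hn)).trans (Finset.single_le_sum
        (f := fun m => F.sum fun n => Finset.univ.sum fun i => (m i - n i).natAbs)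
        (fun _ _ => Nat.zero_le _) hm)
  have := Int.eq_zero_of_dvd_of_natAbs_lt_natAbs h1 (by simpa using by omega)
  omega

/-- An injective choice of large primes. -/
theorem exists_injective_prime_gt (α : Type*) [Countable α] (B : ℕ) :
    ∃ q : α → ℕ, Function.Injective q ∧ ∀ a, (q a).Prime ∧ B < q a := by
  have hinf : {p : ℕ | p.Prime ∧ B < p}.Infinite := by
    refine Set.infinite_of_not_bddAbove fun ⟨K, hK⟩ => ?_
    obtain ⟨p, hp, hpp⟩ := Nat.exists_infinite_primes (B + K + 1)
    have := hK (show p ∈ {p : ℕ | p.Prime ∧ B < p} from ⟨hpp, by omega⟩)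
    omega
  obtain ⟨f, hf⟩ := exists_injective_nat α
  exact ⟨fun a => hinf.natEmbedding _ (f a),
    Subtype.val_injective.comp ((hinf.natEmbedding _).injective.comp hf),
    fun a => (hinf.natEmbedding _ (f a)).2⟩

/-- Prescribed residues modulo finitely many primes, including all primes up to `card F`, can be
realised by a translation `t` such that the remaining primes do not destroy the visibility of any
point of `t + F`. -/
theorem exists_translation_of_residues {d : ℕ} (hd : 2 ≤ d) (F : Finset (Fin d → ℤ))
    {A : Finset ℕ} (hA : ∀ p ∈ A, p.Prime) (hAF : ∀ p : ℕ, p.Prime → p ≤ F.card → p ∈ A)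
    (r : ∀ p, Fin d → ZMod p) :
    ∃ t : Fin d → ℤ, (∀ p ∈ A, redMod p t = r p) ∧
      ∀ n ∈ F, ∀ p : ℕ, p.Prime → p ∉ A → redMod p (t + n) ≠ 0 := by
  classical
  let i₀ : Fin d := ⟨0, by omega⟩
  let i₁ : Fin d := ⟨1, by omega⟩
  have hi : i₁ ≠ i₀ := by simp [i₀, i₁]
  -- Fixing a large coordinate `z` first makes every `z + n i₀` nonzero, so only the finitely many
  -- primes in `D` can divide one of them.
  obtain ⟨z, hzK, hz⟩ := exists_int_gt_eq_residues hA (fun p => r p i₀) (∑ n ∈ F, |n i₀|)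
  have hpos : ∀ n ∈ F, 0 < z + n i₀ := by
    intro n hn
    have := Finset.single_le_sum (f := fun n : Fin d → ℤ => |n i₀|) (fun _ _ => abs_nonneg _) hn
    have := neg_abs_le (n i₀)
    linarith
  let D : Finset ℕ := (∏ n ∈ F, (z + n i₀)).natAbs.primeFactors
  have hD : ∀ n ∈ F, ∀ p : ℕ, p.Prime → (p : ℤ) ∣ z + n i₀ → p ∈ D := by
    intro n hn p hp hdvd
    refine Nat.mem_primeFactors.2 ⟨hp, Int.natCast_dvd.1 (hdvd.trans
      (Finset.dvd_prod_of_mem (fun n : Fin d → ℤ => z + n i₀) hn)), ?_⟩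
    rw [Int.natAbs_ne_zero]
    exact (Finset.prod_pos hpos).ne'
  -- Modulo a prime of `D` outside `A`, coordinate `i₁` avoids all the classes `-n i₁`; such a prime
  -- exceeds `F.card`, so a free class exists.
  have havoid : ∀ p : ℕ, ∃ a : ZMod p, F.card < p → ∀ n ∈ F, a + (n i₁ : ZMod p) ≠ 0 := by
    intro p
    by_cases h : F.card < p
    · obtain ⟨a, ha⟩ := exists_zmod_add_ne_zero F (fun n => n i₁) h
      exact ⟨a, fun _ => ha⟩
    · exact ⟨0, fun h' => absurd h' h⟩
  choose a ha using havoid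
  have hAD : ∀ p ∈ A ∪ D, p.Prime := by
    intro p hp
    rcases Finset.mem_union.1 hp with h | h
    · exact hA p h
    · exact (Nat.mem_primeFactors.1 h).1
  have hy : ∀ i, ∃ y : ℤ, ∀ p ∈ A ∪ D, (y : ZMod p) = if p ∈ A then r p i else a p := fun i =>
    exists_int_eq_residues hAD fun p => if p ∈ A then r p i else a p
  choose y hy using hy
  refine ⟨fun i => if i = i₀ then z else y i, fun p hp => ?_, fun n hn p hp hpA h0 => ?_⟩
  · funext i
    by_cases h : i = i₀
    · simp [redMod, h, hz p hp]
    · simp [redMod, h, hy i p (Finset.mem_union_left _ hp), hp]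
  · have h1 := congrFun h0 i₀
    have h2 := congrFun h0 i₁
    simp only [redMod, Pi.add_apply, if_true, if_neg hi, Pi.zero_apply] at h1 h2
    have hpD := hD n hn p hp ((ZMod.intCast_zmod_eq_zero_iff_dvd _ _).1 h1)
    rw [Int.cast_add, hy i₁ p (Finset.mem_union_right _ hpD), if_neg hpA] at h2
    exact ha p (not_le.1 fun h => hpA (hAF p hp h)) n hn h2

/-- Every finite pattern of an admissible configuration occurs in the set of visible points, at a
position with a prescribed residue modulo a given prime. -/
theorem exists_visiblePoints_eq {d : ℕ} (hd : 2 ≤ d) {x : (Fin d → ℤ) → Bool}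
    {c : ∀ p, Fin d → ZMod p} (hc : ∀ p : ℕ, p.Prime → Misses p (c p) x)
    (F : Finset (Fin d → ℤ)) {p₀ : ℕ} (hp₀ : p₀.Prime) :
    ∃ t : Fin d → ℤ, redMod p₀ t = -c p₀ ∧
      ∀ n ∈ F, configOf (visiblePoints d) (t + n) = x n := by
  classical
  obtain ⟨B₁, hB₁⟩ := exists_bound_redMod_injOn F
  -- Private primes above `B₁` separate the points of `F`; the other two summands put all primes up
  -- to `F.card`, and `p₀`, among the small primes.
  let B := B₁ + F.card + p₀
  obtain ⟨q, hq, hqB⟩ := exists_injective_prime_gt (Fin d → ℤ) B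
  let F₀ := F.filter fun n => x n = false
  let A := (Finset.range (B + 1)).filter Nat.Prime ∪ F₀.image q
  have hA : ∀ p, p ∈ A ↔ (p ≤ B ∧ p.Prime) ∨ ∃ n ∈ F₀, q n = p := by
    intro p
    simp [A]
  -- At the private prime of `n` the residue `-n` makes `t + n` invisible; at small primes `-c p`
  -- moves the missed class to zero.
  let r : ∀ p, Fin d → ZMod p := fun p =>
    if h : ∃ n, q n = p then -redMod p h.choose else -c p
  have hrq : ∀ n, r (q n) = -redMod (q n) n := by
    intro n
    have h : ∃ m, q m = q n := ⟨n, rfl⟩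
    have h' : h.choose = n := hq h.choose_spec
    simp only [r, dif_pos h]
    rw [h']
  have hrc : ∀ p ≤ B, r p = -c p := by
    intro p hp
    have h : ¬ ∃ m, q m = p := by
      rintro ⟨m, rfl⟩
      exact absurd (hqB m).2 (not_lt.2 hp)
    simp only [r, dif_neg h]
  obtain ⟨t, htA, ht⟩ := exists_translation_of_residues hd F (A := A)
    (by
      intro p hp
      rcases (hA p).1 hp with h | ⟨n, -, rfl⟩
      · exact h.2
      · exact (hqB n).1)
    (fun p hp hpF => (hA p).2 (Or.inl ⟨by omega, hp⟩)) r
  refine ⟨t, ?_, fun n hn => ?_⟩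
  · rw [htA p₀ ((hA p₀).2 (Or.inl ⟨by omega, hp₀⟩)), hrc p₀ (by omega)]
  · rw [Bool.eq_iff_iff, configOf_eq_true, mem_visiblePoints_iff]
    constructor
    · intro h
      by_contra hx
      have hn₀ : n ∈ F₀ := Finset.mem_filter.2 ⟨hn, by simpa using hx⟩
      refine h (q n) (hqB n).1 ?_
      rw [redMod_add, htA _ ((hA _).2 (Or.inr ⟨n, hn₀, rfl⟩)), hrq, neg_add_cancel]
    · intro hx p hp h0
      by_cases hpA : p ∈ A
      · rw [redMod_add, htA p hpA] at h0
        rcases (hA p).1 hpA with h | ⟨m, hm, rfl⟩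
        · rw [hrc p h.1, neg_add_eq_zero] at h0
          exact hc p hp n hx h0.symm
        · rw [hrq, neg_add_eq_zero] at h0
          have hm' := Finset.mem_filter.1 hm
          have := hB₁ (q m) (by have := (hqB m).2; omega) m hm'.1 n hn h0
          subst this
          simp [hx] at hm'
      · exact ht n hn p hp hpA h0

/-- A configuration lies in the closure of a set if its finite patterns occur in that set. -/
theorem mem_closure_of_forall_finset {ι : Type*} {s : Set (ι → Bool)} {x : ι → Bool}
    (h : ∀ F : Finset ι, ∃ y ∈ s, ∀ n ∈ F, y n = x n) : x ∈ closure s := by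
  rw [mem_closure_iff]
  intro o ho hx
  obtain ⟨F, u, hu, hsub⟩ := isOpen_pi_iff.1 ho x hx
  obtain ⟨y, hys, hy⟩ := h F
  refine ⟨y, hsub fun n hn => ?_, hys⟩
  rw [hy n hn]
  exact (hu n hn).2

theorem hull_carrier_eq {d : ℕ} (hd : 2 ≤ d) :
    (hull (visiblePoints d)).carrier = {x | IsAdmissible (configSupport x)} := by
  apply Set.Subset.antisymm
  · refine closure_minimal ?_ (isClosed_admissible d)
    rintro _ ⟨t, rfl⟩
    refine (isAdmissible_iff _).2 fun p hp => ⟨-redMod p t, ?_⟩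
    rw [misses_shift_iff, neg_add_cancel]
    exact misses_visiblePoints hp
  · intro x hx
    have : ∀ p : ℕ, ∃ c : Fin d → ZMod p, p.Prime → Misses p c x := by
      intro p
      by_cases hp : p.Prime
      · obtain ⟨c, hc⟩ := (isAdmissible_iff x).1 hx p hp
        exact ⟨c, fun _ => hc⟩
      · exact ⟨0, fun h => absurd h hp⟩
    choose c hc using this
    refine mem_closure_of_forall_finset fun F => ?_
    -- The prescribed residue is not needed here; any prime would do.
    obtain ⟨t, -, ht⟩ := exists_visiblePoints_eq hd hc F Nat.prime_two
    exact ⟨_, ⟨t, rfl⟩, ht⟩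

theorem mem_hull_iff {d : ℕ} (hd : 2 ≤ d) (x : (Fin d → ℤ) → Bool) :
    x ∈ (hull (visiblePoints d)).carrier ↔ ∀ p : ℕ, p.Prime → ∃ c, Misses p c x := by
  rw [hull_carrier_eq hd]
  exact isAdmissible_iff x

open SymbolicDynamics.FullShift (shift)

theorem shiftAction_apply {d : ℕ} (X : SymbolicDynamics.FullShift.Subshift Bool (Fin d → ℤ))
    (t : Multiplicative (Fin d → ℤ)) (x : X.carrier) :
    (shiftAction X t x).val = shift t.toAdd x.val := rfl

/-- Subsets of admissible sets are admissible. -/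
theorem Misses.mono {d p : ℕ} {c : Fin d → ZMod p} {x y : (Fin d → ℤ) → Bool}
    (h : Misses p c x) (hyx : ∀ n, y n = true → x n = true) : Misses p c y :=
  fun n hn => h n (hyx n hn)

theorem mem_hull_of_le {d : ℕ} (hd : 2 ≤ d) {x y : (Fin d → ℤ) → Bool}
    (h : x ∈ (hull (visiblePoints d)).carrier) (hyx : ∀ n, y n = true → x n = true) :
    y ∈ (hull (visiblePoints d)).carrier := by
  rw [mem_hull_iff hd] at h ⊢
  intro p hp
  obtain ⟨c, hc⟩ := h p hp
  exact ⟨c, hc.mono hyx⟩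

theorem misses_singleton_iff {d p : ℕ} (c : Fin d → ZMod p) (m : Fin d → ℤ) :
    Misses p c (configOf {m}) ↔ redMod p m ≠ c := by
  simp [Misses, configOf_eq_true]

/-- Singletons serve as test configurations: modulo each prime, {m} misses exactly the classes other
than that of m. -/
theorem singleton_mem_hull {d : ℕ} (hd : 2 ≤ d) (m : Fin d → ℤ) :
    configOf {m} ∈ (hull (visiblePoints d)).carrier := by
  rw [mem_hull_iff hd]
  intro p hp
  have : Fact p.Prime := ⟨hp⟩
  have : NeZero d := ⟨by omega⟩
  refine ⟨redMod p m + 1, (misses_singleton_iff _ _).2 fun h => ?_⟩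
  simpa using congrFun h 0

theorem shiftAction_injective {d : ℕ} (hd : 2 ≤ d) :
    Function.Injective (shiftAction (hull (visiblePoints d))) := by
  intro s t h
  have h1 := congrArg (fun f => (f ⟨_, singleton_mem_hull hd s.toAdd⟩).val 0) h
  simp only [shiftAction_apply, SymbolicDynamics.FullShift.shift_apply, add_zero] at h1
  have h2 := (configOf_eq_true {s.toAdd} t.toAdd).1
    (h1 ▸ (configOf_eq_true {s.toAdd} s.toAdd).2 rfl)
  exact (Multiplicative.toAdd.injective h2).symm

/-! ### The centraliser of the shifts -/

section Centralizer

variable {d : ℕ}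

/-- The set of visible points, as an element of its hull. -/
noncomputable def visibleConfig (d : ℕ) : (hull (visiblePoints d)).carrier :=
  ⟨configOf (visiblePoints d), subset_closure ⟨0, SymbolicDynamics.FullShift.shift_zero _⟩⟩

theorem exists_misses (hd : 2 ≤ d) (x : (hull (visiblePoints d)).carrier) {p : ℕ} (hp : p.Prime) :
    ∃ c, Misses p c x.val :=
  (mem_hull_iff hd x.val).1 x.2 p hp

/-- The configurations missing the zero class modulo `p` form the orbit closure of the visible
points under the shifts by elements of `p ℤ^d`. -/
theorem mem_closure_of_misses_zero (hd : 2 ≤ d) {p : ℕ} (hp : p.Prime)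
    {x : (hull (visiblePoints d)).carrier} (hx : Misses p 0 x.val) :
    x ∈ closure {y | ∃ t : Fin d → ℤ, redMod p t = 0 ∧
      y = shiftAction (hull (visiblePoints d)) (Multiplicative.ofAdd t) (visibleConfig d)} := by
  have : ∀ q : ℕ, ∃ c : Fin d → ZMod q, (q.Prime → Misses q c x.val) ∧ (q = p → c = 0) := by
    intro q
    by_cases hqp : q = p
    · subst hqp
      exact ⟨0, fun _ => hx, fun _ => rfl⟩
    by_cases hq : q.Prime
    · obtain ⟨c, hc⟩ := exists_misses hd x hq
      exact ⟨c, fun _ => hc, fun h => absurd h hqp⟩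
    · exact ⟨0, fun h => absurd h hq, fun _ => rfl⟩
  choose c hc using this
  rw [closure_subtype]
  refine mem_closure_of_forall_finset fun F => ?_
  obtain ⟨t, htp, ht⟩ := exists_visiblePoints_eq hd (fun q => (hc q).1) F hp
  exact ⟨_, ⟨_, ⟨t, by rw [htp, (hc p).2 rfl, neg_zero], rfl⟩, rfl⟩, ht⟩

variable {S : (hull (visiblePoints d)).carrier ≃ₜ (hull (visiblePoints d)).carrier}

theorem centralizer_commute (hS : S ∈ symmetryGroup (hull (visiblePoints d)))
    (t : Fin d → ℤ) (x : (hull (visiblePoints d)).carrier) :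
    (S (shiftAction (hull (visiblePoints d)) (Multiplicative.ofAdd t) x)).val
      = shift t (S x).val := by
  have h := Subgroup.mem_centralizer_iff.1 hS _ ⟨Multiplicative.ofAdd t, rfl⟩
  have h' := congrArg (fun f => (f x).val) h
  exact h'.symm

/-- A symmetry maps the configurations missing a class `c` modulo `p` to configurations missing
`c + s`, with `s` independent of `c`. -/
theorem exists_misses_add (hd : 2 ≤ d) (hS : S ∈ symmetryGroup (hull (visiblePoints d)))
    {p : ℕ} (hp : p.Prime) :
    ∃ s : Fin d → ZMod p, ∀ c x, Misses p c x.val → Misses p (c + s) (S x).val := by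
  obtain ⟨s, hs⟩ := exists_misses hd (S (visibleConfig d)) hp
  refine ⟨s, ?_⟩
  -- Shifts by p ℤ^d do not move classes modulo p, so the image of this orbit of V misses `s`;
  -- closedness and continuity extend this to the orbit closure.
  have h0 : ∀ x : (hull (visiblePoints d)).carrier, Misses p 0 x.val → Misses p s (S x).val := by
    intro x hx
    refine closure_minimal (s := {y | ∃ t : Fin d → ℤ, redMod p t = 0 ∧
      y = shiftAction (hull (visiblePoints d)) (Multiplicative.ofAdd t) (visibleConfig d)})
      (t := (fun x => (S x).val) ⁻¹' {y | Misses p s y}) ?_ ?_ (mem_closure_of_misses_zero hd hp hx)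
    · rintro _ ⟨t, ht, rfl⟩
      change Misses p s (S _).val
      rw [centralizer_commute hS, misses_shift_iff, ht, add_zero]
      exact hs
    · exact (isClosed_misses s).preimage (continuous_subtype_val.comp S.continuous)
  intro c x hx
  obtain ⟨t, rfl⟩ := redMod_surjective p c
  have h1 := h0 (shiftAction (hull (visiblePoints d)) (Multiplicative.ofAdd t) x) (by
    rw [shiftAction_apply, misses_shift_iff, zero_add]
    exact hx)
  rwa [centralizer_commute hS, misses_shift_iff, add_comm] at h1

/-- If V missed a class c ≠ 0, so would everything in its p ℤ^d-orbit closure, that is, every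
configuration missing 0. A singleton in the class c is a counterexample. -/
theorem eq_zero_of_misses_visiblePoints {p : ℕ} (hd : 2 ≤ d) (hp : p.Prime) {c : Fin d → ZMod p}
    (h : Misses p c (configOf (visiblePoints d))) : c = 0 := by
  by_contra hc
  obtain ⟨n, rfl⟩ := redMod_surjective p c
  have hm : Misses p 0 (configOf {n}) := (misses_singleton_iff _ _).2 hc
  have hcl := mem_closure_of_misses_zero hd hp (x := ⟨_, singleton_mem_hull hd n⟩) hm
  have h2 := closure_minimal (t := Subtype.val ⁻¹' {y | Misses p (redMod p n) y}) (by
    rintro _ ⟨t, ht, rfl⟩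
    change Misses p _ _
    rw [shiftAction_apply, misses_shift_iff]
    rw [toAdd_ofAdd, ht, add_zero]
    exact h) ((isClosed_misses _).preimage continuous_subtype_val) hcl
  exact (misses_singleton_iff _ _).1 h2 rfl

/-- The translations belonging to S and S⁻¹ cancel: V misses 0, hence also their sum, which must
therefore vanish. -/
theorem exists_misses_add_iff (hd : 2 ≤ d) (hS : S ∈ symmetryGroup (hull (visiblePoints d)))
    {p : ℕ} (hp : p.Prime) :
    ∃ s : Fin d → ZMod p, ∀ c x, Misses p c x.val ↔ Misses p (c + s) (S x).val := by
  obtain ⟨s, hs⟩ := exists_misses_add hd hS hp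
  obtain ⟨s', hs'⟩ := exists_misses_add hd (Subgroup.inv_mem _ hS) hp
  have hinv : ∀ x, S⁻¹ (S x) = x := S.symm_apply_apply
  have h0 : s + s' = 0 := by
    refine eq_zero_of_misses_visiblePoints hd hp ?_
    have h1 := hs' _ _ (hs 0 (visibleConfig d) (misses_visiblePoints hp))
    rw [zero_add, hinv] at h1
    exact h1
  refine ⟨s, fun c x => ⟨hs c x, fun h => ?_⟩⟩
  have h1 := hs' _ _ h
  rwa [hinv, add_assoc, h0, add_zero] at h1

/-- A set missing every residue class modulo a prime that a finite set misses is contained in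
that finite set. -/
theorem le_of_misses_imp {x y : (Fin d → ℤ) → Bool} {F : Finset (Fin d → ℤ)}
    (hF : ∀ n, x n = true → n ∈ F)
    (h : ∀ p : ℕ, p.Prime → ∀ c, Misses p c x → Misses p c y) (n : Fin d → ℤ)
    (hn : y n = true) : x n = true := by
  classical
  by_contra hx
  -- Modulo a large prime, `n` is in no class of a point of `F`, so `x` misses the class of `n`
  -- while `y` does not.
  obtain ⟨B, hB⟩ := exists_bound_redMod_injOn (insert n F)
  obtain ⟨p, hp, hpp⟩ := Nat.exists_infinite_primes (B + 1)
  refine h p hpp (redMod p n) (fun m hm hmn => hx ?_) n hn rfl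
  rwa [← hB p (by omega) m (Finset.mem_insert_of_mem (hF m hm)) n (Finset.mem_insert_self _ _) hmn]

theorem eq_one_of_misses_iff (hd : 2 ≤ d)
    (h : ∀ p : ℕ, p.Prime → ∀ c x, Misses p c x.val ↔ Misses p c (S x).val) : S = 1 := by
  classical
  have hfin : ∀ (F : Finset (Fin d → ℤ)) (x : (hull (visiblePoints d)).carrier),
      (∀ n, x.val n = true → n ∈ F) → S x = x := by
    intro F x hF
    -- The preimage is treated first: this inclusion makes it finite, so the same lemma then yields
    -- the reverse inclusion.
    have h1 : ∀ n, (S.symm x).val n = true → x.val n = true :=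
      le_of_misses_imp hF fun p hp c hc => (h p hp c _).2 (by rwa [S.apply_symm_apply])
    have h2 : ∀ n, x.val n = true → (S.symm x).val n = true := by
      refine le_of_misses_imp (fun n hn => hF n (h1 n hn)) fun p hp c hc => ?_
      have := (h p hp c _).1 hc
      rwa [S.apply_symm_apply] at this
    have h3 : S.symm x = x := Subtype.ext (funext fun n => Bool.eq_iff_iff.2 ⟨h1 n, h2 n⟩)
    conv_lhs => rw [← h3]
    exact S.apply_symm_apply x
  have hdense : Dense {x : (hull (visiblePoints d)).carrier |
      ∃ F : Finset (Fin d → ℤ), ∀ n, x.val n = true → n ∈ F} := by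
    intro x
    rw [closure_subtype]
    refine mem_closure_of_forall_finset fun F => ?_
    -- Truncations to finite windows stay in the hull because admissibility passes to subsets.
    refine ⟨configOf {n | n ∈ F ∧ x.val n = true}, ⟨⟨_, mem_hull_of_le hd x.2 ?_⟩, ⟨F, ?_⟩, rfl⟩, ?_⟩
    · exact fun n hn => ((configOf_eq_true _ _).1 hn).2
    · exact fun n hn => ((configOf_eq_true _ _).1 hn).1
    · intro n hn
      rw [Bool.eq_iff_iff, configOf_eq_true]
      exact and_iff_right hn
  refine Homeomorph.ext fun x => ?_
  exact congrFun (Continuous.ext_on hdense S.continuous continuous_id fun x ⟨F, hF⟩ => hfin F x hF) x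

/-- The class shifts of a symmetry come from a single lattice vector. -/
theorem exists_redMod_eq_of_misses_add (hd : 2 ≤ d) {s : ∀ p, Fin d → ZMod p}
    (hs : ∀ p : ℕ, p.Prime → ∀ c x, Misses p c x.val ↔ Misses p (c + s p) (S x).val) :
    ∃ m : Fin d → ℤ, ∀ p : ℕ, p.Prime → redMod p m = s p := by
  let x₀ : (hull (visiblePoints d)).carrier := ⟨_, singleton_mem_hull hd 0⟩
  have hmem : ∀ m, (S x₀).val m = true → ∀ p : ℕ, p.Prime → redMod p m = s p := by
    intro m hm p hp
    by_contra hne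
    have h1 : Misses p (redMod p m - s p) x₀.val := by
      refine (misses_singleton_iff _ _).2 fun h => hne ?_
      rw [redMod_zero] at h
      exact sub_eq_zero.1 h.symm
    have h2 := (hs p hp _ _).1 h1
    rw [sub_add_cancel] at h2
    exact h2 m hm rfl
  by_cases hex : ∃ m, (S x₀).val m = true
  · obtain ⟨m, hm⟩ := hex
    exact ⟨m, hmem m hm⟩
  -- An empty image would miss every class modulo 2, forcing {0} to miss the zero class.
  · exfalso
    push Not at hex
    have h1 : Misses 2 (0 : Fin d → ZMod 2) x₀.val :=
      (hs 2 Nat.prime_two _ _).2 fun n hn => absurd hn (hex n)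
    exact (misses_singleton_iff _ _).1 h1 redMod_zero

theorem symmetryGroup_hull_eq (hd : 2 ≤ d) :
    symmetryGroup (hull (visiblePoints d)) = (shiftAction (hull (visiblePoints d))).range := by
  apply le_antisymm
  · intro S hS
    have : ∀ p : ℕ, ∃ s : Fin d → ZMod p,
        p.Prime → ∀ c x, Misses p c x.val ↔ Misses p (c + s) (S x).val := by
      intro p
      by_cases hp : p.Prime
      · obtain ⟨s, hs⟩ := exists_misses_add_iff hd hS hp
        exact ⟨s, fun _ => hs⟩
      · exact ⟨0, fun h => absurd h hp⟩
    choose s hs using this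
    obtain ⟨m, hm⟩ := exists_redMod_eq_of_misses_add hd hs
    have h1 : shiftAction (hull (visiblePoints d)) (Multiplicative.ofAdd m) * S = 1 := by
      refine eq_one_of_misses_iff hd fun p hp c x => ?_
      rw [hs p hp c x, ← hm p hp]
      exact (misses_shift_iff c m (S x).val).symm
    rw [← inv_eq_of_mul_eq_one_right h1, ← map_inv]
    exact ⟨_, rfl⟩
  · rintro _ ⟨t, rfl⟩
    refine Subgroup.mem_centralizer_iff.2 ?_
    rintro _ ⟨s, rfl⟩
    rw [← map_mul, ← map_mul, mul_comm]

end Centralizer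

/-! ### The action of GL(d, ℤ) and the normaliser -/

open Matrix in
theorem redMod_mulVec_congr {d p : ℕ} (A : Matrix (Fin d) (Fin d) ℤ) {m n : Fin d → ℤ}
    (h : redMod p m = redMod p n) : redMod p (A *ᵥ m) = redMod p (A *ᵥ n) := by
  rw [redMod_eq_iff] at h ⊢
  intro i
  simp only [Matrix.mulVec, dotProduct, ← Finset.sum_sub_distrib, ← mul_sub]
  exact Finset.dvd_sum fun j _ => (h j).mul_left _

theorem gl_inv_mulVec_mulVec {d : ℕ} (M : Matrix.GeneralLinearGroup (Fin d) ℤ) (n : Fin d → ℤ) :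
    M⁻¹.val.mulVec (M.val.mulVec n) = n := by
  rw [Matrix.mulVec_mulVec, ← Units.val_mul, inv_mul_cancel, Units.val_one, Matrix.one_mulVec]

theorem gl_mulVec_inv_mulVec {d : ℕ} (M : Matrix.GeneralLinearGroup (Fin d) ℤ) (n : Fin d → ℤ) :
    M.val.mulVec (M⁻¹.val.mulVec n) = n := by
  rw [Matrix.mulVec_mulVec, ← Units.val_mul, mul_inv_cancel, Units.val_one, Matrix.one_mulVec]

theorem comp_mulVec_mem_hull {d : ℕ} (hd : 2 ≤ d) (M : Matrix.GeneralLinearGroup (Fin d) ℤ)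
    {x : (Fin d → ℤ) → Bool} (hx : x ∈ (hull (visiblePoints d)).carrier) :
    (fun n => x (M⁻¹.val.mulVec n)) ∈ (hull (visiblePoints d)).carrier := by
  rw [mem_hull_iff hd] at hx ⊢
  intro p hp
  obtain ⟨c, hc⟩ := hx p hp
  obtain ⟨c, rfl⟩ := redMod_surjective p c
  refine ⟨redMod p (M.val.mulVec c), fun n hn h => hc _ hn ?_⟩
  rw [redMod_mulVec_congr _ h, gl_inv_mulVec_mulVec]

theorem continuous_comp_subtype {ι A : Type*} [TopologicalSpace A] {X : Set (ι → A)} (g : ι → ι)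
    (h : ∀ x : X, (fun n => x.val (g n)) ∈ X) :
    Continuous fun x : X => (⟨fun n => x.val (g n), h x⟩ : X) :=
  (continuous_pi fun n => (continuous_apply (g n)).comp continuous_subtype_val).subtype_mk h

/-- The action of `GL(d, ℤ)` on the hull of the visible points, `(H_M x)_n = x_(M⁻¹ n)`. -/
noncomputable def glAction {d : ℕ} (hd : 2 ≤ d) : Matrix.GeneralLinearGroup (Fin d) ℤ →*
    ((hull (visiblePoints d)).carrier ≃ₜ (hull (visiblePoints d)).carrier) where
  toFun M :=
    { toFun := fun x => ⟨fun n => x.val (M⁻¹.val.mulVec n), comp_mulVec_mem_hull hd M x.2⟩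
      invFun := fun x => ⟨fun n => x.val (M⁻¹⁻¹.val.mulVec n), comp_mulVec_mem_hull hd M⁻¹ x.2⟩
      left_inv := fun x => Subtype.ext <| funext fun n =>
        congrArg x.val (by rw [gl_mulVec_inv_mulVec])
      right_inv := fun x => Subtype.ext <| funext fun n =>
        congrArg x.val (by rw [gl_inv_mulVec_mulVec])
      continuous_toFun := continuous_comp_subtype (fun n => M⁻¹.val.mulVec n) _
      continuous_invFun := continuous_comp_subtype (fun n => M⁻¹⁻¹.val.mulVec n) _ }
  map_one' := by
    refine Homeomorph.ext fun x => Subtype.ext <| funext fun n => congrArg x.val ?_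
    rw [inv_one, Units.val_one, Matrix.one_mulVec]
  map_mul' M N := by
    refine Homeomorph.ext fun x => Subtype.ext <| funext fun n => congrArg x.val ?_
    rw [mul_inv_rev, Units.val_mul, Matrix.mulVec_mulVec]

theorem glAction_conj {d : ℕ} (hd : 2 ≤ d) (M : Matrix.GeneralLinearGroup (Fin d) ℤ)
    (t : Multiplicative (Fin d → ℤ)) :
    glAction hd M * shiftAction (hull (visiblePoints d)) t * (glAction hd M)⁻¹
      = shiftAction (hull (visiblePoints d)) (glAut d M t) := by
  rw [mul_inv_eq_iff_eq_mul]
  refine Homeomorph.ext fun x => Subtype.ext <| funext fun n => congrArg x.val ?_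
  change t.toAdd + M⁻¹.val.mulVec n = M⁻¹.val.mulVec (M.val.mulVec t.toAdd + n)
  rw [Matrix.mulVec_add, gl_inv_mulVec_mulVec]

/-- The homomorphism `(t, M) ↦ T_t ∘ H_M`. -/
noncomputable def semidirectAction {d : ℕ} (hd : 2 ≤ d) :
    Multiplicative (Fin d → ℤ) ⋊[glAut d] Matrix.GeneralLinearGroup (Fin d) ℤ →*
      ((hull (visiblePoints d)).carrier ≃ₜ (hull (visiblePoints d)).carrier) :=
  SemidirectProduct.lift (shiftAction _) (glAction hd) fun M =>
    MonoidHom.ext fun t => (glAction_conj hd M t).symm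

/-- Fixing the singleton of the origin forces t = 0; fixing those of the basis vectors then forces M
= 1. -/
theorem semidirectAction_injective {d : ℕ} (hd : 2 ≤ d) :
    Function.Injective (semidirectAction hd) := by
  rw [injective_iff_map_eq_one]
  rintro ⟨t, M⟩ h
  have key : ∀ m n : Fin d → ℤ,
      M⁻¹.val.mulVec (t.toAdd + n) = m ↔ n = m := by
    intro m n
    have h1 := congrArg (fun f => (f ⟨_, singleton_mem_hull hd m⟩).val n) h
    rw [← Set.mem_singleton_iff, ← Set.mem_singleton_iff (a := n), ← configOf_eq_true,
      ← configOf_eq_true {m} n]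
    exact Bool.eq_iff_iff.1 h1
  have ht : t.toAdd = 0 := by
    have := (key 0 0).2 rfl
    rw [add_zero] at this
    rw [← gl_mulVec_inv_mulVec M t.toAdd, this, Matrix.mulVec_zero]
  have hM : M⁻¹ = 1 := by
    refine Units.ext (Matrix.ext_of_mulVec_single fun i => ?_)
    have := (key (Pi.single i 1) (Pi.single i 1)).2 rfl
    rw [ht, zero_add] at this
    rw [this, Units.val_one, Matrix.one_mulVec]
  exact SemidirectProduct.ext ht (inv_eq_one.1 hM)

/-- Conjugation permutes the shifts; since the action is faithful, this is an additive endomorphism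
of ℤ^d, hence a matrix. -/
theorem extendedSymmetryGroup_conj {d : ℕ} {X : SymbolicDynamics.FullShift.Subshift Bool (Fin d → ℤ)}
    (hX : Function.Injective (shiftAction X)) {S : X.carrier ≃ₜ X.carrier}
    (hS : S ∈ extendedSymmetryGroup X) :
    ∃ A : Matrix (Fin d) (Fin d) ℤ, ∀ t : Fin d → ℤ,
      S * shiftAction X (Multiplicative.ofAdd t) * S⁻¹
        = shiftAction X (Multiplicative.ofAdd (A.mulVec t)) := by
  have h : ∀ t : Fin d → ℤ, ∃ s, shiftAction X s
      = S * shiftAction X (Multiplicative.ofAdd t) * S⁻¹ := fun t =>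
    (Subgroup.mem_normalizer_iff.1 hS _).1 ⟨_, rfl⟩
  choose f hf using h
  let g : (Fin d → ℤ) →+ (Fin d → ℤ) := AddMonoidHom.mk' (fun t => (f t).toAdd) fun s t => by
    have : f (s + t) = f s * f t := hX <| by
      rw [map_mul, hf, hf, hf, ofAdd_add, map_mul]
      group
    rw [this, toAdd_mul]
  refine ⟨LinearMap.toMatrix' g.toIntLinearMap, fun t => ?_⟩
  rw [LinearMap.toMatrix'_mulVec, ← hf]
  rfl

theorem range_semidirectAction {d : ℕ} (hd : 2 ≤ d) :
    (semidirectAction hd).range = extendedSymmetryGroup (hull (visiblePoints d)) := by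
  have hgl : ∀ M, glAction hd M ∈ extendedSymmetryGroup (hull (visiblePoints d)) := by
    intro M
    refine Subgroup.mem_normalizer_iff.2 fun h => ⟨?_, ?_⟩
    · rintro ⟨t, rfl⟩
      exact ⟨_, (glAction_conj hd M t).symm⟩
    · rintro ⟨t, ht⟩
      refine ⟨glAut d M⁻¹ t, ?_⟩
      rw [← glAction_conj hd, ht, map_inv]
      group
  apply le_antisymm
  · rintro _ ⟨⟨t, M⟩, rfl⟩
    exact Subgroup.mul_mem _ (Subgroup.le_normalizer ⟨t, rfl⟩) (hgl M)
  · intro S hS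
    have hinj := shiftAction_injective hd
    obtain ⟨A, hA⟩ := extendedSymmetryGroup_conj hinj hS
    obtain ⟨B, hB⟩ := extendedSymmetryGroup_conj hinj (Subgroup.inv_mem _ hS)
    have hAB : ∀ t, A.mulVec (B.mulVec t) = t := fun t => Multiplicative.ofAdd.injective <| hinj <| by
      rw [← hA, ← hB]; group
    have hBA : ∀ t, B.mulVec (A.mulVec t) = t := fun t => Multiplicative.ofAdd.injective <| hinj <| by
      rw [← hB, ← hA]; group
    let M : Matrix.GeneralLinearGroup (Fin d) ℤ :=
      ⟨A, B, Matrix.ext_of_mulVec_single fun i => by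
          rw [← Matrix.mulVec_mulVec, hAB, Matrix.one_mulVec],
        Matrix.ext_of_mulVec_single fun i => by
          rw [← Matrix.mulVec_mulVec, hBA, Matrix.one_mulVec]⟩
    -- `S` and H_M conjugate every shift in the same way, so their quotient commutes with all
    -- shifts.
    have hcomm : S * (glAction hd M)⁻¹ ∈ symmetryGroup (hull (visiblePoints d)) := by
      refine Subgroup.mem_centralizer_iff.2 ?_
      rintro _ ⟨t, rfl⟩
      have h1 := glAction_conj hd M (glAut d M⁻¹ t)
      have h2 : S * shiftAction _ (glAut d M⁻¹ t) * S⁻¹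
          = shiftAction (hull (visiblePoints d)) (glAut d M (glAut d M⁻¹ t)) :=
        hA (glAut d M⁻¹ t).toAdd
      have h3 : glAut d M (glAut d M⁻¹ t) = t := by
        rw [← MulAut.mul_apply, ← map_mul, mul_inv_cancel, map_one, MulAut.one_apply]
      rw [h3] at h1 h2
      conv_lhs => rw [← h2]
      conv_rhs => rw [← h1]
      group
    rw [symmetryGroup_hull_eq hd] at hcomm
    obtain ⟨t, ht⟩ := hcomm
    refine ⟨⟨t, M⟩, ?_⟩
    change shiftAction _ t * glAction hd M = S
    rw [ht, inv_mul_cancel_right]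

theorem exists_extendedSymmetryGroup_equiv {d : ℕ} (hd : 2 ≤ d) :
    ∃ Φ : Multiplicative (Fin d → ℤ) ⋊[glAut d] Matrix.GeneralLinearGroup (Fin d) ℤ ≃*
        extendedSymmetryGroup (hull (visiblePoints d)),
      (∀ t, (Φ (SemidirectProduct.inl t)).val = shiftAction (hull (visiblePoints d)) t) ∧
      ∀ (M : Matrix.GeneralLinearGroup (Fin d) ℤ) (x : (hull (visiblePoints d)).carrier)
        (n : Fin d → ℤ),
        ((Φ (SemidirectProduct.inr M)).val x).val n = x.val (M⁻¹.val.mulVec n) := by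
  refine ⟨(MonoidHom.ofInjective (semidirectAction_injective hd)).trans
    (MulEquiv.subgroupCongr (range_semidirectAction hd)), fun t => ?_, fun M x n => ?_⟩
  · have : semidirectAction hd (SemidirectProduct.inl t) = shiftAction _ t :=
      SemidirectProduct.lift_inl _ _ _ t
    exact this
  · have : semidirectAction hd (SemidirectProduct.inr M) = glAction hd M :=
      SemidirectProduct.lift_inr _ _ _ M
    exact congrArg (fun f => (f x).val n) this

/-! ### The Euler product -/

theorem one_sub_inv_pow_pos {d : ℕ} (hd : 2 ≤ d) {p : ℕ} (hp : p.Prime) :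
    0 < 1 - ((p : ℝ) ^ d)⁻¹ := by
  have h1 : (1 : ℝ) < p := by exact_mod_cast hp.one_lt
  have h2 : (1 : ℝ) < (p : ℝ) ^ d := one_lt_pow₀ h1 (by omega)
  have := inv_lt_one_of_one_lt₀ h2
  linarith

/-- Euler product for `1 / ζ(d)`, with `d` a natural number. -/
theorem tendsto_prod_one_sub_inv_pow {d : ℕ} (hd : 2 ≤ d) :
    Filter.Tendsto (fun P : ℕ => ∏ p ∈ P.primesBelow, (1 - ((p : ℝ) ^ d)⁻¹)) Filter.atTop
      (nhds ((riemannZeta (d : ℂ)).re)⁻¹) := by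
  have h1 := riemannZeta_eulerProduct (s := (d : ℂ)) (by simp; omega)
  have h2 : Filter.Tendsto (fun P : ℕ => (∏ p ∈ P.primesBelow, (1 - ((p : ℝ) ^ d)⁻¹))⁻¹)
      Filter.atTop (nhds (riemannZeta (d : ℂ)).re) := by
    refine ((Complex.continuous_re.tendsto _).comp h1).congr fun P => ?_
    simp only [Function.comp_apply]
    rw [← Complex.ofReal_re (∏ p ∈ P.primesBelow, (1 - ((p : ℝ) ^ d)⁻¹))⁻¹]
    congr 1
    push_cast
    rw [← Finset.prod_inv_distrib]
    refine Finset.prod_congr rfl fun p _ => ?_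
    rw [Complex.cpow_neg, Complex.cpow_natCast]
  -- Nonvanishing of the limit is what allows inverting the convergence.
  have h3 : 1 ≤ (riemannZeta (d : ℂ)).re := by
    refine ge_of_tendsto' h2 fun P => (one_le_inv₀ ?_).2 ?_
    · exact Finset.prod_pos fun p hp => one_sub_inv_pow_pos hd (Nat.prime_of_mem_primesBelow hp)
    · refine Finset.prod_le_one (fun p hp => (one_sub_inv_pow_pos hd
        (Nat.prime_of_mem_primesBelow hp)).le) fun p _ => ?_
      have : 0 ≤ ((p : ℝ) ^ d)⁻¹ := by positivity
      linarith
  simpa using h2.inv₀ (by linarith)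

theorem inv_zeta_le_prod {d : ℕ} (hd : 2 ≤ d) (P : ℕ) :
    ((riemannZeta (d : ℂ)).re)⁻¹ ≤ ∏ p ∈ P.primesBelow, (1 - ((p : ℝ) ^ d)⁻¹) := by
  refine Antitone.le_of_tendsto (fun P Q h => ?_) (tendsto_prod_one_sub_inv_pow hd) P
  refine Finset.prod_le_prod_of_subset_of_le_one (fun p hp => ?_) (fun p hp =>
    (one_sub_inv_pow_pos hd (Nat.prime_of_mem_primesBelow hp)).le) fun p _ _ => ?_
  · rw [Nat.mem_primesBelow] at hp ⊢
    exact ⟨hp.1.trans_le h, hp.2⟩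
  · have : 0 ≤ ((p : ℝ) ^ d)⁻¹ := by positivity
    linarith

/-! ### Open covers and finite patterns -/

open Classical in
/-- The finite patterns of `X` with shape `F`, as subsets of `F`. -/
noncomputable def patternFinset {ι : Type*} (X : Set (ι → Bool)) (F : Finset ι) :
    Finset (Finset ι) :=
  F.powerset.filter fun A => ∃ x ∈ X, F.filter (fun n => x n = true) = A

theorem filter_mem_patternFinset {ι : Type*} {X : Set (ι → Bool)} (F : Finset ι)
    {x : ι → Bool} (hx : x ∈ X) : F.filter (fun n => x n = true) ∈ patternFinset X F := by
  classical
  exact Finset.mem_filter.2 ⟨Finset.mem_powerset.2 (Finset.filter_subset _ _), x, hx, rfl⟩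

/-- Every open cover of a compact set of configurations is refined by the cylinders over some
finite window. -/
theorem exists_window {ι : Type*} {X : Set (ι → Bool)} (hX : IsClosed X) {𝒰 : Set (Set X)}
    (ho : ∀ u ∈ 𝒰, IsOpen u) (hc : ⋃₀ 𝒰 = Set.univ) :
    ∃ W : Finset ι, ∀ x : X, ∃ u ∈ 𝒰, ∀ y : X, (∀ n ∈ W, y.val n = x.val n) → y ∈ u := by
  classical
  have hloc : ∀ x : X, ∃ W : Finset ι, ∃ u ∈ 𝒰, ∀ y : X, (∀ n ∈ W, y.val n = x.val n) → y ∈ u := by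
    intro x
    obtain ⟨u, hu, hxu⟩ := Set.mem_sUnion.1 (hc ▸ Set.mem_univ x)
    obtain ⟨v, hv, rfl⟩ := isOpen_induced_iff.1 (ho u hu)
    obtain ⟨W, w, hw, hsub⟩ := isOpen_pi_iff.1 hv x.val hxu
    refine ⟨W, _, hu, fun y hy => hsub fun n hn => ?_⟩
    rw [hy n hn]
    exact (hw n hn).2
  choose W u hu hW using hloc
  have : CompactSpace X := isCompact_iff_compactSpace.1 hX.isCompact
  -- Finitely many cylinders cover `X`; the union of their windows works for all points at once.
  obtain ⟨t, ht⟩ := isCompact_univ.elim_finite_subcover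
    (fun x : X => {y : X | ∀ n ∈ W x, y.val n = x.val n})
    (fun x => by
      exact (SymbolicDynamics.FullShift.isOpen_cylinder (W x) x.val).preimage
        continuous_subtype_val)
    (fun x _ => Set.mem_iUnion.2 ⟨x, fun n _ => rfl⟩)
  refine ⟨t.biUnion W, fun x => ?_⟩
  obtain ⟨z, hz, hxz⟩ := Set.mem_iUnion₂.1 (ht (Set.mem_univ x))
  refine ⟨u z, hu z, fun y hy => hW z y fun n hn => ?_⟩
  rw [hy n (Finset.mem_biUnion.2 ⟨z, hz, hn⟩), hxz n hn]

/-- Since F contains E + W, a pattern on F determines the W-window of every T_t x with t in E, so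
one member of the join per pattern suffices. -/
theorem exists_subcover_card_le {d : ℕ} (X : SymbolicDynamics.FullShift.Subshift Bool (Fin d → ℤ))
    {𝒰 : Set (Set X.carrier)} {W E F : Finset (Fin d → ℤ)}
    (hW : ∀ x : X.carrier, ∃ u ∈ 𝒰, ∀ y : X.carrier, (∀ n ∈ W, y.val n = x.val n) → y ∈ u)
    (hF : ∀ t ∈ E, ∀ n ∈ W, t + n ∈ F) :
    ∃ ℱ : Finset (Set X.carrier), (ℱ : Set (Set X.carrier)) ⊆
        joinCover (fun t : Fin d → ℤ => shiftAction X (Multiplicative.ofAdd t)) 𝒰 E ∧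
      ⋃₀ (ℱ : Set (Set X.carrier)) = Set.univ ∧ ℱ.card ≤ (patternFinset X.carrier F).card := by
  classical
  choose u hu hWu using hW
  have hrep : ∀ A : patternFinset X.carrier F,
      ∃ x : X.carrier, F.filter (fun n => x.val n = true) = A := by
    rintro ⟨A, hA⟩
    obtain ⟨x, hx, h⟩ := (Finset.mem_filter.1 hA).2
    exact ⟨⟨x, hx⟩, h⟩
  choose rep hrep using hrep
  let w : patternFinset X.carrier F → Set X.carrier := fun A => ⋂ t ∈ E,
    (shiftAction X (Multiplicative.ofAdd t)) ⁻¹' u (shiftAction X (Multiplicative.ofAdd t) (rep A))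
  refine ⟨Finset.univ.image w, ?_, ?_, ?_⟩
  · intro v hv
    obtain ⟨A, -, rfl⟩ := Finset.mem_image.1 hv
    exact ⟨fun t => u (shiftAction X (Multiplicative.ofAdd t) (rep A)), fun t _ => hu _, rfl⟩
  · refine Set.eq_univ_of_forall fun y => ?_
    let A : patternFinset X.carrier F := ⟨_, filter_mem_patternFinset F y.2⟩
    refine Set.mem_sUnion.2 ⟨w A, by simp, Set.mem_iInter₂.2 fun t ht => hWu _ _ fun n hn => ?_⟩
    have h1 := Finset.ext_iff.1 (hrep A) (t + n)
    simp only [A, Finset.mem_filter, hF t ht n hn, true_and] at h1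
    exact (Bool.eq_iff_iff.2 h1).symm
  · exact Finset.card_image_le.trans (by simp)

theorem minSubcoverCard_le {d : ℕ} (X : SymbolicDynamics.FullShift.Subshift Bool (Fin d → ℤ))
    {𝒰 : Set (Set X.carrier)} {W E F : Finset (Fin d → ℤ)}
    (hW : ∀ x : X.carrier, ∃ u ∈ 𝒰, ∀ y : X.carrier, (∀ n ∈ W, y.val n = x.val n) → y ∈ u)
    (hF : ∀ t ∈ E, ∀ n ∈ W, t + n ∈ F) :
    minSubcoverCard (joinCover (fun t : Fin d → ℤ => shiftAction X (Multiplicative.ofAdd t)) 𝒰 E)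
      ≤ (patternFinset X.carrier F).card := by
  obtain ⟨ℱ, h1, h2, h3⟩ := exists_subcover_card_le X hW hF
  exact le_trans (Nat.sInf_le ⟨ℱ, h1, h2, rfl⟩) h3

/-- The partition of a subshift according to the symbol at the origin. -/
def originPartition {d : ℕ} (X : SymbolicDynamics.FullShift.Subshift Bool (Fin d → ℤ)) :
    Set (Set X.carrier) :=
  Set.range fun b : Bool => {x : X.carrier | x.val 0 = b}

theorem isOpen_of_mem_originPartition {d : ℕ}
    (X : SymbolicDynamics.FullShift.Subshift Bool (Fin d → ℤ)) :
    ∀ u ∈ originPartition X, IsOpen u := by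
  rintro _ ⟨b, rfl⟩
  have : {x : X.carrier | x.val 0 = b} = (fun x : X.carrier => x.val 0) ⁻¹' {b} := by
    ext x; simp
  simp only [this]
  exact (isOpen_discrete _).preimage ((continuous_apply 0).comp continuous_subtype_val)

theorem sUnion_originPartition {d : ℕ}
    (X : SymbolicDynamics.FullShift.Subshift Bool (Fin d → ℤ)) :
    ⋃₀ originPartition X = Set.univ :=
  Set.eq_univ_of_forall fun x => ⟨_, ⟨x.val 0, rfl⟩, rfl⟩

/-- A member of this join fixes all symbols on E, so distinct subsets of G need distinct members of
the cover. -/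
theorem two_pow_le_minSubcoverCard {d : ℕ}
    (X : SymbolicDynamics.FullShift.Subshift Bool (Fin d → ℤ)) {E G : Finset (Fin d → ℤ)}
    (hGE : G ⊆ E) (hG : ∀ A ⊆ G, configOf (A : Set (Fin d → ℤ)) ∈ X.carrier) :
    2 ^ G.card ≤ minSubcoverCard (joinCover
      (fun t : Fin d → ℤ => shiftAction X (Multiplicative.ofAdd t)) (originPartition X) E) := by
  classical
  obtain ⟨W, hW⟩ := exists_window X.isClosed (isOpen_of_mem_originPartition X)
    (sUnion_originPartition X)
  -- Some finite subcover must exist, because the infimum of the empty set of naturals is 0.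
  obtain ⟨ℱ₀, h1, h2, -⟩ := exists_subcover_card_le X (E := E)
    (F := (E ×ˢ W).image fun z => z.1 + z.2) hW
    fun t ht n hn => Finset.mem_image.2 ⟨(t, n), Finset.mem_product.2 ⟨ht, hn⟩, rfl⟩
  refine le_csInf ⟨_, ℱ₀, h1, h2, rfl⟩ ?_
  rintro _ ⟨ℱ, hsub, hcov, rfl⟩
  rw [← Finset.card_powerset]
  have hmem : ∀ A : Finset (Fin d → ℤ), ∃ v, A ⊆ G → v ∈ ℱ ∧
      ∀ h : configOf (A : Set (Fin d → ℤ)) ∈ X.carrier, (⟨_, h⟩ : X.carrier) ∈ v := by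
    intro A
    by_cases hA : A ⊆ G
    · obtain ⟨v, hv, hAv⟩ := Set.mem_sUnion.1 (hcov ▸ Set.mem_univ (⟨_, hG A hA⟩ : X.carrier))
      exact ⟨v, fun _ => ⟨hv, fun _ => hAv⟩⟩
    · exact ⟨∅, fun h => absurd h hA⟩
  choose v hv using hmem
  refine Finset.card_le_card_of_injOn v
    (fun A hA => (hv A (Finset.mem_powerset.1 hA)).1) fun A hA B hB hAB => ?_
  have hA' := Finset.mem_powerset.1 hA
  have hB' := Finset.mem_powerset.1 hB
  obtain ⟨u, hu, huv⟩ := hsub (hv A hA').1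
  have hmA := (hv A hA').2 (hG A hA')
  have hmB := (hv B hB').2 (hG B hB')
  rw [← hAB] at hmB
  rw [huv] at hmA hmB
  ext n
  by_cases hn : n ∈ E
  · obtain ⟨b, hb⟩ := hu n hn
    have e1 := Set.mem_iInter₂.1 hmA n hn
    have e2 := Set.mem_iInter₂.1 hmB n hn
    rw [← hb] at e1 e2
    change configOf (A : Set (Fin d → ℤ)) (n + 0) = b at e1
    change configOf (B : Set (Fin d → ℤ)) (n + 0) = b at e2
    rw [← e2, Bool.eq_iff_iff, configOf_eq_true, configOf_eq_true, add_zero] at e1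
    simpa using e1
  · exact iff_of_false (fun h => hn (hGE (hA' h))) fun h => hn (hGE (hB' h))

/-! ### Counting patterns from above -/

theorem redMod_eq_iff_emod {d p : ℕ} (m n : Fin d → ℤ) :
    redMod p m = redMod p n ↔ (fun i => m i % (p : ℤ)) = fun i => n i % (p : ℤ) := by
  simp only [funext_iff, redMod]
  exact forall_congr' fun i => ZMod.intCast_eq_intCast_iff' _ _ _

/-- The number of points of a cube of side `k ∏ p` outside one residue class for each `p`. -/
theorem card_box_filter_le {d : ℕ} {s : Finset ℕ} (hs : ∀ p ∈ s, p.Prime) (a : ℤ) (k : ℕ)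
    (b : s → Fin d → ℤ) :
    ((Fintype.piFinset fun _ : Fin d => Finset.Ico a (a + k * ∏ p ∈ s, (p : ℤ))).filter
      fun n => ∀ p : s, redMod p n ≠ redMod p (b p)).card ≤ k ^ d * ∏ p ∈ s, (p ^ d - 1) := by
  classical
  set N : ℤ := ∏ p ∈ s, (p : ℤ) with hN
  have hNpos : 0 < N := Finset.prod_pos fun p hp => by exact_mod_cast (hs p hp).pos
  -- A point is encoded by its block of side `N` and its residues modulo each `p`; by coprimality of
  -- the primes this determines it.
  let T := (Fintype.piFinset fun _ : Fin d => Finset.Ico 0 (k : ℤ)) ×ˢ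
    (Fintype.piFinset fun p : s => (Fintype.piFinset fun _ : Fin d => Finset.Ico 0 (p : ℤ)).erase
      fun i => b p i % (p : ℤ))
  have hT : T.card = k ^ d * ∏ p ∈ s, (p ^ d - 1) := by
    rw [Finset.card_product, Fintype.card_piFinset, Fintype.card_piFinset]
    congr 1
    · simp
    · rw [← Finset.prod_coe_sort s fun p => p ^ d - 1]
      refine Finset.prod_congr rfl fun p _ => ?_
      rw [Finset.card_erase_of_mem, Fintype.card_piFinset]
      · simp
      · have : 0 < ((p : ℕ) : ℤ) := by exact_mod_cast (hs p p.2).pos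
        simp [Int.emod_nonneg _ this.ne', Int.emod_lt_of_pos _ this]
  rw [← hT]
  refine Finset.card_le_card_of_injOn
    (fun n => (fun i => (n i - a) / N, fun p i => n i % (p : ℤ))) ?_ ?_
  · intro n hn
    simp only [Finset.coe_filter, Set.mem_ofPred_eq, Fintype.mem_piFinset, Finset.mem_Ico] at hn
    refine Finset.mem_product.2 ⟨Fintype.mem_piFinset.2 fun i => ?_,
      Fintype.mem_piFinset.2 fun p => Finset.mem_erase.2 ⟨?_, Fintype.mem_piFinset.2 fun i => ?_⟩⟩
    · have := hn.1 i
      exact Finset.mem_Ico.2 ⟨Int.ediv_nonneg (by linarith) hNpos.le,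
        Int.ediv_lt_of_lt_mul hNpos (by linarith)⟩
    · exact fun h => hn.2 p ((redMod_eq_iff_emod _ _).2 h)
    · have : 0 < ((p : ℕ) : ℤ) := by exact_mod_cast (hs p p.2).pos
      exact Finset.mem_Ico.2 ⟨Int.emod_nonneg _ this.ne', Int.emod_lt_of_pos _ this⟩
  · intro m _ n _ h
    obtain ⟨h1, h2⟩ := Prod.ext_iff.1 h
    funext i
    have hdvd : N ∣ m i - n i := by
      refine Finset.prod_dvd_of_coprime (fun p hp q hq hpq => ?_) fun p hp => ?_
      · exact Nat.isCoprime_iff_coprime.2 ((Nat.coprime_primes (hs p hp) (hs q hq)).2 hpq)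
      · exact Int.ModEq.dvd (congrFun (congrFun h2 ⟨p, hp⟩) i).symm
    have e1 : (m i - a) / N = (n i - a) / N := congrFun h1 i
    have e2 : (m i - a) % N = (n i - a) % N :=
      (Int.modEq_iff_dvd.2 (by simpa using hdvd)).symm
    have e3 := Int.mul_ediv_add_emod (m i - a) N
    have e4 := Int.mul_ediv_add_emod (n i - a) N
    rw [e1, e2] at e3
    linarith

/-- The first factor counts the choices of a missed class for each prime, the second bounds the
subsets of the points left over. -/
theorem card_patternFinset_le {d : ℕ} (hd : 2 ≤ d) {s : Finset ℕ} (hs : ∀ p ∈ s, p.Prime) (a : ℤ)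
    (k : ℕ) :
    (patternFinset (hull (visiblePoints d)).carrier
      (Fintype.piFinset fun _ : Fin d => Finset.Ico a (a + k * ∏ p ∈ s, (p : ℤ)))).card
      ≤ (∏ p ∈ s, p ^ d) * 2 ^ (k ^ d * ∏ p ∈ s, (p ^ d - 1)) := by
  classical
  set F := Fintype.piFinset fun _ : Fin d => Finset.Ico a (a + k * ∏ p ∈ s, (p : ℤ)) with hF
  let B : Finset (s → Fin d → ℤ) :=
    Fintype.piFinset fun p : s => Fintype.piFinset fun _ : Fin d => Finset.Ico 0 (p : ℤ)
  have hB : B.card = ∏ p ∈ s, p ^ d := by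
    rw [Fintype.card_piFinset, ← Finset.prod_coe_sort s fun p => p ^ d]
    refine Finset.prod_congr rfl fun p _ => ?_
    simp
  rw [← hB]
  refine (Finset.card_le_card (t := B.biUnion fun b => (F.filter
    fun n => ∀ p : s, redMod p n ≠ redMod p (b p)).powerset) ?_).trans
    (Finset.card_biUnion_le_card_mul _ _ _ fun b _ => ?_)
  · intro A hA
    obtain ⟨x, hx, rfl⟩ := (Finset.mem_filter.1 hA).2
    have hc : ∀ p : s, ∃ c ∈ Fintype.piFinset fun _ : Fin d => Finset.Ico 0 ((p : ℕ) : ℤ),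
        Misses p (redMod p c) x := by
      intro p
      obtain ⟨c, hc⟩ := (mem_hull_iff hd x).1 hx p (hs p p.2)
      obtain ⟨c, rfl⟩ := redMod_surjective _ c
      have hp : 0 < ((p : ℕ) : ℤ) := by exact_mod_cast (hs p p.2).pos
      refine ⟨fun i => c i % (p : ℤ), by
        simp [Int.emod_nonneg _ hp.ne', Int.emod_lt_of_pos _ hp], ?_⟩
      have : redMod (p : ℕ) (fun i => c i % ((p : ℕ) : ℤ)) = redMod p c :=
        (redMod_eq_iff_emod _ _).2 (funext fun i => Int.emod_emod_of_dvd _ dvd_rfl)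
      rwa [this]
    choose b hb hbx using hc
    refine Finset.mem_biUnion.2 ⟨b, Fintype.mem_piFinset.2 hb, Finset.mem_powerset.2 ?_⟩
    intro n hn
    obtain ⟨h1, h2⟩ := Finset.mem_filter.1 hn
    exact Finset.mem_filter.2 ⟨h1, fun p => hbx p n h2⟩
  · rw [Finset.card_powerset]
    exact Nat.pow_le_pow_right two_pos (card_box_filter_le hs a k b)

/-! ### Free sets and the lower entropy bound -/

/-- Greedy choice of residue classes that remove few points of a finite set. -/
theorem exists_residues_card_filter_ge {d : ℕ} (F : Finset (Fin d → ℤ)) (s : Finset ℕ)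
    (hs : ∀ p ∈ s, p.Prime) :
    ∃ G ⊆ F, (∀ p ∈ s, ∃ c : Fin d → ZMod p, ∀ n ∈ G, redMod p n ≠ c) ∧
      (F.card : ℝ) * ∏ p ∈ s, (1 - ((p : ℝ) ^ d)⁻¹) ≤ G.card := by
  classical
  induction s using Finset.induction_on with
  | empty => exact ⟨F, subset_rfl, by simp, by simp⟩
  | insert p s hps ih =>
    obtain ⟨G, hGF, hG, hcard⟩ := ih fun q hq => hs q (Finset.mem_insert_of_mem hq)
    have hp : p.Prime := hs p (Finset.mem_insert_self _ _)
    have : NeZero p := ⟨hp.ne_zero⟩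
    have hppos : (0 : ℝ) < (p : ℝ) ^ d := by
      have : (0 : ℝ) < p := by exact_mod_cast hp.pos
      positivity
    -- Among the p^d classes, some class contains at most the average number of points of `G`.
    obtain ⟨c, -, hc⟩ := Finset.exists_card_fiber_le_of_card_le_nsmul (s := G)
      (t := (Finset.univ : Finset (Fin d → ZMod p))) (f := redMod p)
      (b := (G.card : ℝ) * ((p : ℝ) ^ d)⁻¹) Finset.univ_nonempty (by
        rw [Finset.card_univ, Fintype.card_fun, ZMod.card, Fintype.card_fin, nsmul_eq_mul]
        push_cast
        field_simp
        rfl)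
    refine ⟨G.filter fun n => redMod p n ≠ c, (Finset.filter_subset _ _).trans hGF, ?_, ?_⟩
    · intro q hq
      rcases Finset.mem_insert.1 hq with rfl | hq
      · exact ⟨c, fun n hn => (Finset.mem_filter.1 hn).2⟩
      · obtain ⟨e, he⟩ := hG q hq
        exact ⟨e, fun n hn => he n (Finset.mem_filter.1 hn).1⟩
    · have h1 : ((G.filter fun n => redMod p n = c).card : ℝ)
          + (G.filter fun n => redMod p n ≠ c).card = G.card := by
        exact_mod_cast Finset.card_filter_add_card_filter_not (s := G) fun n => redMod p n = c
      rw [Finset.prod_insert hps]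
      have h2 : 0 ≤ 1 - ((p : ℝ) ^ d)⁻¹ := by
        have h3 : (1 : ℝ) ≤ (p : ℝ) ^ d := one_le_pow₀ (by exact_mod_cast hp.one_le)
        have := inv_le_one_of_one_le₀ h3
        linarith
      have h4 := mul_le_mul_of_nonneg_right hcard h2
      nlinarith

theorem exists_free_subset {d : ℕ} (hd : 2 ≤ d) (F : Finset (Fin d → ℤ)) :
    ∃ G ⊆ F, (∀ A ⊆ G, configOf (A : Set (Fin d → ℤ)) ∈ (hull (visiblePoints d)).carrier) ∧
      (F.card : ℝ) * ((riemannZeta (d : ℂ)).re)⁻¹ ≤ G.card := by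
  obtain ⟨G, hGF, hG, hcard⟩ := exists_residues_card_filter_ge F (F.card + 1).primesBelow
    fun p hp => Nat.prime_of_mem_primesBelow hp
  refine ⟨G, hGF, fun A hA => (mem_hull_iff hd _).2 fun p hp => ?_,
    (mul_le_mul_of_nonneg_left (inv_zeta_le_prod hd _) (by positivity)).trans hcard⟩
  have hmem : ∀ n, configOf (A : Set (Fin d → ℤ)) n = true → n ∈ G := fun n hn =>
    hA (by simpa using (configOf_eq_true _ _).1 hn)
  by_cases hpF : p ≤ F.card
  · obtain ⟨c, hc⟩ := hG p (Nat.mem_primesBelow.2 ⟨by omega, hp⟩)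
    exact ⟨c, fun n hn => hc n (hmem n hn)⟩
  · have : NeZero d := ⟨by omega⟩
    -- A prime above `F.card` costs nothing: the first coordinates of `F` cannot fill all its
    -- classes.
    obtain ⟨a, ha⟩ := exists_zmod_add_ne_zero F (fun n => n 0) (not_le.1 hpF)
    refine ⟨fun _ => -a, fun n hn h => ha n (hGF (hmem n hn)) ?_⟩
    have := congrFun h 0
    simp only [redMod] at this
    rw [this, add_neg_cancel]

theorem card_cube (d n : ℕ) : (cube d n).card = n ^ d := by
  simp [cube]

theorem le_topologicalEntropy {d : ℕ} (hd : 2 ≤ d) :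
    ((Real.log 2 / (riemannZeta (d : ℂ)).re : ℝ) : EReal)
      ≤ topologicalEntropy (shiftAction (hull (visiblePoints d))) := by
  refine le_trans ?_ (le_iSup₂ (originPartition (hull (visiblePoints d)))
    ⟨isOpen_of_mem_originPartition _, sUnion_originPartition _⟩)
  conv_lhs => rw [← Filter.limsup_const (f := Filter.atTop (α := ℕ))
    ((Real.log 2 / (riemannZeta (d : ℂ)).re : ℝ) : EReal)]
  refine Filter.limsup_le_limsup ?_
  filter_upwards [Filter.eventually_ge_atTop 1] with n hn
  rw [EReal.coe_le_coe_iff]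
  obtain ⟨G, hGF, hG, hcard⟩ := exists_free_subset hd (cube d n)
  have h1 := two_pow_le_minSubcoverCard (hull (visiblePoints d)) hGF hG
  have hnpos : (0 : ℝ) < (n : ℝ) ^ d := by
    have : (0 : ℝ) < n := by exact_mod_cast hn
    positivity
  rw [le_div_iff₀ hnpos]
  have h2 : Real.log ((2 : ℝ) ^ G.card) ≤ Real.log (minSubcoverCard (joinCover
      (fun t : Fin d → ℤ => shiftAction (hull (visiblePoints d)) (Multiplicative.ofAdd t))
      (originPartition (hull (visiblePoints d))) (cube d n))) :=
    Real.log_le_log (by positivity) (by exact_mod_cast h1)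
  refine le_trans ?_ h2
  rw [Real.log_pow]
  rw [card_cube] at hcard
  push_cast at hcard
  have := mul_le_mul_of_nonneg_right hcard (Real.log_pos one_lt_two).le
  calc _ = (n : ℝ) ^ d * ((riemannZeta (d : ℂ)).re)⁻¹ * Real.log 2 := by rw [div_eq_mul_inv]; ring
    _ ≤ _ := this

/-! ### The upper entropy bound -/

theorem limsup_minSubcoverCard_le {d : ℕ} (hd : 2 ≤ d)
    {𝒰 : Set (Set (hull (visiblePoints d)).carrier)} (ho : ∀ u ∈ 𝒰, IsOpen u)
    (hc : ⋃₀ 𝒰 = Set.univ) (P : ℕ) :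
    Filter.limsup (fun n : ℕ =>
      ((Real.log (minSubcoverCard
        (joinCover (fun t : Fin d → ℤ => shiftAction (hull (visiblePoints d))
          (Multiplicative.ofAdd t)) 𝒰 (cube d n))) / (n : ℝ) ^ d : ℝ) : EReal)) Filter.atTop
      ≤ ((Real.log 2 * ∏ p ∈ P.primesBelow, (1 - ((p : ℝ) ^ d)⁻¹) : ℝ) : EReal) := by
  obtain ⟨W, hW⟩ := exists_window (hull (visiblePoints d)).isClosed ho hc
  have hs : ∀ p ∈ P.primesBelow, p.Prime := fun p hp => Nat.prime_of_mem_primesBelow hp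
  set s := P.primesBelow with hsdef
  obtain ⟨R, hR⟩ : ∃ R : ℕ, ∀ n ∈ W, ∀ i, |n i| ≤ R := by
    refine ⟨W.sum fun n => Finset.univ.sum fun i => (n i).natAbs, fun n hn i => ?_⟩
    have h1 : (n i).natAbs ≤ W.sum fun n => Finset.univ.sum fun i => (n i).natAbs :=
      (Finset.single_le_sum (f := fun i => (n i).natAbs) (fun _ _ => Nat.zero_le _)
        (Finset.mem_univ i)).trans (Finset.single_le_sum
          (f := fun n : Fin d → ℤ => Finset.univ.sum fun i => (n i).natAbs)
          (fun _ _ => Nat.zero_le _) hn)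
    rw [Int.abs_eq_natAbs]
    exact_mod_cast h1
  let N : ℕ := ∏ p ∈ s, p
  have hN : 0 < N := Finset.prod_pos fun p hp => (hs p hp).pos
  have hNR : (0 : ℝ) < N := by exact_mod_cast hN
  -- Enlarging the cube by the window radius and rounding its side up to a multiple of `N` adds at
  -- most `C`; `K` is the logarithm of the number of class choices. Both are negligible after
  -- division by n^d.
  let C : ℝ := 2 * R + N
  let e : ℝ := ∏ p ∈ s, (1 - ((p : ℝ) ^ d)⁻¹)
  let K : ℝ := Real.log ((N : ℝ) ^ d)
  have hlim : Filter.Tendsto (fun n : ℕ => K * ((n : ℝ)⁻¹) ^ d + Real.log 2 * e *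
      (1 + C * (n : ℝ)⁻¹) ^ d) Filter.atTop (nhds (Real.log 2 * e)) := by
    have h0 := tendsto_inv_atTop_nhds_zero_nat (𝕜 := ℝ)
    have h1 := ((h0.pow d).const_mul K).add
      ((((h0.const_mul C).const_add 1).pow d).const_mul (Real.log 2 * e))
    simpa [show d ≠ 0 by omega] using h1
  have hlimE := (continuous_coe_real_ereal.tendsto (Real.log 2 * e)).comp hlim
  rw [← hlimE.limsup_eq]
  refine Filter.limsup_le_limsup ?_
  filter_upwards [Filter.eventually_ge_atTop 1] with n hn
  simp only [Function.comp_apply]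
  rw [EReal.coe_le_coe_iff]
  have hn0 : (0 : ℝ) < n := by exact_mod_cast hn
  let k : ℕ := (n + 2 * R) / N + 1
  have hk : n + 2 * R ≤ k * N := by
    have := Nat.lt_div_mul_add (a := n + 2 * R) hN
    simp only [k, add_mul, one_mul]
    exact this.le
  have hkR : (k : ℝ) ≤ (n + C) / N := by
    rw [le_div_iff₀ hNR]
    have h1 : k * N ≤ n + 2 * R + N := by
      simp only [k, add_mul, one_mul]
      exact Nat.add_le_add_right (Nat.div_mul_le_self _ _) _
    have h2 : (k : ℝ) * N ≤ n + 2 * R + N := by exact_mod_cast h1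
    simp only [C]
    linarith
  have hcover := minSubcoverCard_le (hull (visiblePoints d)) (E := cube d n)
    (F := Fintype.piFinset fun _ : Fin d => Finset.Ico (-(R : ℤ)) (-(R : ℤ) + k * ∏ p ∈ s, (p : ℤ)))
    hW (by
      intro t ht m hm
      refine Fintype.mem_piFinset.2 fun i => Finset.mem_Ico.2 ?_
      have h1 := Finset.mem_Ico.1 (Fintype.mem_piFinset.1 ht i)
      have h2 := abs_le.1 (hR m hm i)
      have h3 : (n : ℤ) + 2 * R ≤ k * ∏ p ∈ s, (p : ℤ) := by
        rw [← Nat.cast_prod]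
        exact_mod_cast hk
      simp only [Pi.add_apply]
      constructor <;> linarith)
  have hcount := hcover.trans (card_patternFinset_le hd hs _ k)
  set m := minSubcoverCard (joinCover (fun t : Fin d → ℤ => shiftAction (hull (visiblePoints d))
          (Multiplicative.ofAdd t)) 𝒰 (cube d n)) with hm
  have hprod : ((∏ p ∈ s, (p ^ d - 1) : ℕ) : ℝ) = (N : ℝ) ^ d * e := by
    simp only [N, e]
    push_cast
    rw [← Finset.prod_pow, ← Finset.prod_mul_distrib]
    refine Finset.prod_congr rfl fun p hp => ?_
    have h1 : 1 ≤ p ^ d := Nat.one_le_pow _ _ (hs p hp).pos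
    have h2 : (p : ℝ) ^ d ≠ 0 := pow_ne_zero _ (by exact_mod_cast (hs p hp).ne_zero)
    rw [Nat.cast_sub h1, mul_sub, mul_inv_cancel₀ h2]
    simp
  have he : 0 ≤ e := Finset.prod_nonneg fun p hp => (one_sub_inv_pow_pos hd (hs p hp)).le
  have hexp : ((k ^ d * ∏ p ∈ s, (p ^ d - 1) : ℕ) : ℝ) ≤ (n + C) ^ d * e := by
    rw [Nat.cast_mul, hprod, Nat.cast_pow]
    calc (k : ℝ) ^ d * ((N : ℝ) ^ d * e) ≤ ((n + C) / N) ^ d * ((N : ℝ) ^ d * e) := by gcongr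
      _ = (n + C) ^ d * e := by rw [div_pow]; field_simp
  have hlog : Real.log m ≤ K + Real.log 2 * ((n + C) ^ d * e) := by
    have hpow : ((∏ p ∈ s, p ^ d : ℕ) : ℝ) = (N : ℝ) ^ d := by
      rw [Finset.prod_pow]; simp [N]
    -- For `m = 0` the bound rests on the convention log 0 = 0.
    rcases Nat.eq_zero_or_pos m with h0 | hpos
    · rw [h0, Nat.cast_zero, Real.log_zero]
      have hK : 0 ≤ K := Real.log_nonneg (one_le_pow₀ (by exact_mod_cast hN))
      have := (Real.log_pos one_lt_two).le
      positivity
    · have h1 : (m : ℝ) ≤ (N : ℝ) ^ d * 2 ^ (k ^ d * ∏ p ∈ s, (p ^ d - 1)) := by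
        rw [← hpow]; exact_mod_cast hcount
      refine (Real.log_le_log (by exact_mod_cast hpos) h1).trans ?_
      rw [Real.log_mul (by positivity) (by positivity), Real.log_pow 2,
        mul_comm _ (Real.log 2)]
      have := (Real.log_pos one_lt_two).le
      gcongr
  rw [div_le_iff₀ (by positivity)]
  refine hlog.trans (le_of_eq ?_)
  have h1 : (n : ℝ) + C = n * (1 + C * (n : ℝ)⁻¹) := by field_simp
  have h2 : K * (n : ℝ)⁻¹ ^ d * (n : ℝ) ^ d = K := by
    rw [mul_assoc, ← mul_pow, inv_mul_cancel₀ hn0.ne', one_pow, mul_one]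
  rw [h1, mul_pow, add_mul _ _ ((n : ℝ) ^ d), h2]
  ring

theorem topologicalEntropy_hull_eq {d : ℕ} (hd : 2 ≤ d) :
    topologicalEntropy (shiftAction (hull (visiblePoints d)))
      = ((Real.log 2 / (riemannZeta (d : ℂ)).re : ℝ) : EReal) := by
  refine le_antisymm (iSup₂_le fun 𝒰 h𝒰 => ?_) (le_topologicalEntropy hd)
  have hlim := (tendsto_prod_one_sub_inv_pow hd).const_mul (Real.log 2)
  rw [← div_eq_mul_inv] at hlim
  exact ge_of_tendsto' ((continuous_coe_real_ereal.tendsto _).comp hlim)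
    fun P => limsup_minSubcoverCard_le hd h𝒰.1 h𝒰.2 P

theorem theorem4p1 (d : ℕ) (hd : 2 ≤ d) :
    -- the two descriptions of the visible points agree
    visiblePoints d = (⋃ p ∈ {p : ℕ | p.Prime}, latticeCoset p (0 : Fin d → ℤ))ᶜ ∧
    -- topological entropy
    topologicalEntropy (shiftAction (hull (visiblePoints d)))
      = ((Real.log 2 / (riemannZeta (d : ℂ)).re : ℝ) : EReal) ∧
    -- the hull is the set of all admissible configurations
    (hull (visiblePoints d)).carrier = {x | IsAdmissible (configSupport x)} ∧
    -- the centraliser consists of the shifts only, and these form a copy of `ℤ^d`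
    Function.Injective (shiftAction (hull (visiblePoints d))) ∧
    symmetryGroup (hull (visiblePoints d)) = (shiftAction (hull (visiblePoints d))).range ∧
    -- the normaliser is `ℤ^d ⋊ GL(d, ℤ)`, with `t` acting as the shift by `t` and `M` acting as
    -- `x ↦ (x_(M⁻¹ n))_n`
    ∃ Φ : Multiplicative (Fin d → ℤ) ⋊[glAut d] Matrix.GeneralLinearGroup (Fin d) ℤ ≃*
        extendedSymmetryGroup (hull (visiblePoints d)),
      (∀ t, (Φ (SemidirectProduct.inl t)).val = shiftAction (hull (visiblePoints d)) t) ∧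
      ∀ (M : Matrix.GeneralLinearGroup (Fin d) ℤ) (x : (hull (visiblePoints d)).carrier)
        (n : Fin d → ℤ),
        ((Φ (SemidirectProduct.inr M)).val x).val n = x.val (M⁻¹.val.mulVec n) := by
  exact ⟨visiblePoints_eq_compl_iUnion d, topologicalEntropy_hull_eq hd, hull_carrier_eq hd,
    shiftAction_injective hd, symmetryGroup_hull_eq hd, exists_extendedSymmetryGroup_equiv hd⟩
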